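/- Theorem A. Let $d\in\mathbb{N}$ and $0\le\alpha<d$. Then there exists a non-empty compact set $K\subset\mathbb{R}^d$ with $\dim_{\mathrm{H}}K=\dim_{\mathrm{A}}K=\alpha$ such that every microset $E$ of $K$ satisfies $\dim_{\mathrm{ML}}E=0$. In particular, for every $s>0$, no microset $E$ of $K$ contains an Ahlfors--David $s$-regular subset. Here $\mathbb{R}^d$ carries the Euclidean metric, $B(x,r)$ is the closed ball with centre $x$ and radius $r$, $\dim_{\mathrm{H}}$ is the Hausdorff dimension, and $N_r(F)$ is the least number of closed balls of radius $r$ centred in $F$ required to cover $F$. The Assouad dimension is $$\dim_{\mathrm{A}}K=\inf\Bigl\{a>0:\exists C>0\ \forall\,0<r\le R<1\ \forall x\in K\quad N_r(B(x,R)\cap K)\le C\Bigl(\frac Rr\Bigr)^a\Bigr\},$$ the lower dimension is $$\dim_{\mathrm{L}}K=\sup\Bigl\{a>0:\exists C>0\ \forall\,0<r\le R<1\ \forall x\in K\quad N_r(B(x,R)\cap K)\ge C\Bigl(\frac Rr\Bigr)^a\Bigr\}$$ (with $\sup\varnothing=0$), and the modified lower dimension is $\dim_{\mathrm{ML}}K=\sup\{\dim_{\mathrm{L}}E:\varnothing\ne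 E\subset K\}$. A microset of a compact set $K$ is a non-empty compact set which is a limit, in the Hausdorff metric, of sets $\lambda_n(K-x_n)\cap B(0,1)$ with $x_n\in K$ and $\lambda_n\ge 1$. A non-empty set $F\subset\mathbb{R}^d$ is Ahlfors--David $s$-regular if there are a Borel measure $\mu$ with $\mu(\mathbb{R}^d\setminus F)=0$ and a constant $C>0$ such that $C^{-1}r^s\le\mu(B(x,r))\le Cr^s$ for all $x\in F$ and all $0<r\le\max\{1,\operatorname{diam}F\}$, $r<\infty$ (so that a single point is not $s$-regular for any $s>0$). -/

import Mathlib

open Set Filter Topology MeasureTheory Metric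
open scoped NNReal ENNReal

/-- The Assouad dimension of a subset `K` of a metric space. Here
`coveringNumber r F` is the least number of closed balls of radius `r` centred in `F`
needed to cover `F`. -/
noncomputable def assouadDim {X : Type*} [MetricSpace X] (K : Set X) : ℝ≥0∞ :=
  ⨅ (α : ℝ≥0) (_ : 0 < α ∧ ∃ C : ℝ≥0, 0 < C ∧
      ∀ r R : ℝ≥0, 0 < r → r ≤ R → R < 1 → ∀ x ∈ K,
        (coveringNumber r (closedBall x R ∩ K) : ℝ≥0∞)
          ≤ ((C * (R / r) ^ (α : ℝ) : ℝ≥0) : ℝ≥0∞)),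
    (α : ℝ≥0∞)

/-- The lower dimension of a subset `K` of a metric space (the supremum of the empty set
of exponents is `0`). -/
noncomputable def lowerDim {X : Type*} [MetricSpace X] (K : Set X) : ℝ≥0∞ :=
  ⨆ (α : ℝ≥0) (_ : 0 < α ∧ ∃ C : ℝ≥0, 0 < C ∧
      ∀ r R : ℝ≥0, 0 < r → r ≤ R → R < 1 → ∀ x ∈ K,
        ((C * (R / r) ^ (α : ℝ) : ℝ≥0) : ℝ≥0∞)
          ≤ (coveringNumber r (closedBall x R ∩ K) : ℝ≥0∞)),
    (α : ℝ≥0∞)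

/-- The modified lower dimension: the supremum of the lower dimensions of all non-empty
subsets. -/
noncomputable def modifiedLowerDim {X : Type*} [MetricSpace X] (K : Set X) : ℝ≥0∞ :=
  ⨆ (E : Set X) (_ : E.Nonempty ∧ E ⊆ K), lowerDim E

/-- The miniset `c (K - x) ∩ B(0, 1)` of `K`. -/
def miniset {d : ℕ} (K : Set (EuclideanSpace ℝ (Fin d))) (x : EuclideanSpace ℝ (Fin d))
    (c : ℝ) : Set (EuclideanSpace ℝ (Fin d)) :=
  (fun y => c • (y - x)) '' K ∩ closedBall 0 1

/-- The microsets of `K`: the non-empty compact sets which are limits, in the Hausdorff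
metric, of minisets `c (K - x) ∩ B(0, 1)` with `x ∈ K` and `1 ≤ c`. -/
def microsets {d : ℕ} (K : Set (EuclideanSpace ℝ (Fin d))) :
    Set (Set (EuclideanSpace ℝ (Fin d))) :=
  {E | E.Nonempty ∧ IsCompact E ∧
    ∃ (x : ℕ → EuclideanSpace ℝ (Fin d)) (c : ℕ → ℝ),
      (∀ n, x n ∈ K) ∧ (∀ n, 1 ≤ c n) ∧
      Tendsto (fun n => hausdorffEDist (miniset K (x n) (c n)) E) atTop (𝓝 0)}

/-- `F` is Ahlfors--David `s`-regular: it is non-empty and carries a Borel measure `μ` such that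
`μ (B(x, r))` is comparable to `r ^ s` for all `x ∈ F` and all radii `r` up to the diameter of `F`.
The radii always include those in `(0, 1]`; up to a change of the constant this matters only for
one-point sets, which thereby are regular for `s = 0` only. -/
def IsAhlforsDavidRegular {X : Type*} [MetricSpace X] [MeasurableSpace X] [BorelSpace X]
    (s : ℝ) (F : Set X) : Prop :=
  F.Nonempty ∧ ∃ (μ : Measure X) (C : ℝ), 0 < C ∧ μ Fᶜ = 0 ∧
    ∀ x ∈ F, ∀ r : ℝ, 0 < r → ENNReal.ofReal r ≤ max 1 (ediam F) →
      ENNReal.ofReal (C⁻¹ * r ^ s) ≤ μ (closedBall x r) ∧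
        μ (closedBall x r) ≤ ENNReal.ofReal (C * r ^ s)

/-! Large empty annuli around every point, at every scale up to a bounded factor, survive
magnification and Hausdorff limits and pass to subsets. They rule out positive lower dimension and
regular measures, since nothing of the set lies between radii `R / M` and `R`.

For `α > 0` take the `d`-fold product of the Cantor set of sums `∑ xᵢ δᵢ`, with `δ n = 2 ^ (-(β n +
ε v₂(n!)))` and `β + ε = d / α`. The ratio `δ n / δ (n + 1) = 2 ^ (β + ε v₂(n + 1))` is large
whenever a high power of 2 divides `n + 1`, hence in every sufficiently long window of indices: this
gives the annuli. Yet `v₂(n!)` differs from `n` only by `O(log n)`, so the jumps average out.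
Superadditivity of `v₂(n!)` makes the count uniform in the starting scale, so the Assouad dimension
is at most `α`; `v₂(n!) ≤ n` gives the Hausdorff lower bound. -/

/-- Every ball centred in `K` with radius at most one contains, at a uniformly comparable scale,
an annulus of prescribed ratio which misses `K`. -/
def UniformlyGapped {X : Type*} [MetricSpace X] (K : Set X) : Prop :=
  ∀ M : ℝ, 1 ≤ M → ∃ ρ : ℝ, 0 < ρ ∧ ∀ x ∈ K, ∀ R : ℝ, 0 < R → R ≤ 1 →
    ∃ R' : ℝ, ρ * R ≤ R' ∧ R' ≤ R ∧ K ∩ closedBall x R' ⊆ closedBall x (R' / M)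

/-- Every point of `E` is the centre of annuli of arbitrarily large ratio, with outer radius less
than one, which miss `E`. -/
def HasGaps {X : Type*} [MetricSpace X] (E : Set X) : Prop :=
  ∀ M : ℝ, 1 ≤ M → ∀ x ∈ E, ∃ R : ℝ, 0 < R ∧ R < 1 ∧ E ∩ closedBall x R ⊆ closedBall x (R / M)

/-! ### Gaps, microsets and lower dimension -/

theorem HasGaps.mono {X : Type*} [MetricSpace X] {E F : Set X} (hE : HasGaps E) (hF : F ⊆ E) :
    HasGaps F := by
  intro M hM x hx
  obtain ⟨R, hR0, hR1, hR⟩ := hE M hM x (hF hx)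
  exact ⟨R, hR0, hR1, fun y hy => hR ⟨hF hy.1, hy.2⟩⟩

theorem uniformlyGapped_singleton {X : Type*} [MetricSpace X] (x : X) :
    UniformlyGapped ({x} : Set X) := by
  intro M hM
  refine ⟨1, one_pos, fun y hy R hR _ => ⟨R, by simp, le_rfl, ?_⟩⟩
  rintro z ⟨hz, -⟩
  rw [mem_singleton_iff] at hy hz
  subst hy hz
  exact mem_closedBall_self (by positivity)

/-- Since `ρ` depends on neither centre nor radius, magnified gaps keep their size as `c n → ∞`. A
gap of ratio `4 * M` in a close miniset leaves one of ratio `M` in the limit. -/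
theorem UniformlyGapped.hasGaps_of_mem_microsets {d : ℕ} {K E : Set (EuclideanSpace ℝ (Fin d))}
    (hK : UniformlyGapped K) (hE : E ∈ microsets K) : HasGaps E := by
  obtain ⟨-, -, x, c, hx, hc, hlim⟩ := hE
  intro M hM y hy
  obtain ⟨ρ, hρ, hgap⟩ := hK (4 * M) (by linarith)
  -- The magnified radius `c n * R` will be at least `ρ / 2`, so `η ≤ c n * R / (32 * M)`: two
  -- approximation errors fit into the slack at both the outer and the inner radius.
  set η : ℝ := ρ / (64 * M) with hη
  have hη0 : 0 < η := by positivity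
  obtain ⟨n, hn⟩ := (hlim.eventually (gt_mem_nhds (ENNReal.ofReal_pos.2 hη0))).exists
  have hc0 : 0 < c n := one_pos.trans_le (hc n)
  obtain ⟨y', hy', hyy'⟩ := exists_edist_lt_of_hausdorffEDist_lt hy
    (by rw [hausdorffEDist_comm]; exact hn)
  obtain ⟨⟨k, hk, rfl⟩, -⟩ := hy'
  obtain ⟨R, hR1, hR2, hR⟩ := hgap k hk (1 / (2 * c n)) (by positivity) (by
    rw [div_le_one (by positivity)]; linarith [hc n])
  have e1 : ρ / 2 ≤ c n * R := by
    calc ρ / 2 = c n * (ρ * (1 / (2 * c n))) := by field_simp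
      _ ≤ c n * R := mul_le_mul_of_nonneg_left hR1 hc0.le
  have e2 : c n * R ≤ 1 / 2 := by
    calc c n * R ≤ c n * (1 / (2 * c n)) := mul_le_mul_of_nonneg_left hR2 hc0.le
      _ = 1 / 2 := by field_simp
  have hcR : 0 < c n * R := by linarith
  have hηR : η ≤ c n * R / (32 * M) := by
    rw [hη, div_le_div_iff₀ (by positivity) (by positivity)]
    nlinarith
  have hηR' : c n * R / (32 * M) ≤ c n * R / 32 :=
    div_le_div_of_nonneg_left hcR.le (by norm_num) (by linarith)
  rw [edist_dist, ENNReal.ofReal_lt_ofReal_iff hη0] at hyy'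
  refine ⟨c n * R / 2, by linarith, by linarith, ?_⟩
  rintro z ⟨hz, hzy⟩
  rw [mem_closedBall] at hzy ⊢
  obtain ⟨z', hz', hzz'⟩ := exists_edist_lt_of_hausdorffEDist_lt hz
    (by rw [hausdorffEDist_comm]; exact hn)
  obtain ⟨⟨l, hl, rfl⟩, -⟩ := hz'
  rw [edist_dist, ENNReal.ofReal_lt_ofReal_iff hη0] at hzz'
  have hdist : dist (c n • (l - x n)) (c n • (k - x n)) = c n * dist l k := by
    rw [dist_smul₀, dist_sub_right, Real.norm_of_nonneg hc0.le]
  have h1 : c n * dist l k ≤ c n * R := by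
    rw [dist_comm y] at hyy'
    rw [← hdist]
    have := dist_triangle4 (c n • (l - x n)) z y (c n • (k - x n))
    rw [dist_comm (c n • (l - x n)) z, dist_comm y] at this
    linarith
  have h2 : dist l k ≤ R / (4 * M) := hR ⟨hl, le_of_mul_le_mul_left h1 hc0⟩
  have h3 : c n * dist l k ≤ c n * R / (4 * M) := by
    rw [mul_div_assoc]
    exact mul_le_mul_of_nonneg_left h2 hc0.le
  have t2 := dist_triangle4 z (c n • (l - x n)) (c n • (k - x n)) y
  rw [dist_comm (c n • (k - x n)) y, hdist] at t2
  have h4 : c n * R / (4 * M) = 8 * (c n * R / (32 * M)) := by field_simp; ring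
  have h5 : c n * R / 2 / M = 16 * (c n * R / (32 * M)) := by field_simp; ring
  rw [h5]
  beta_reduce at hyy' hzz'
  linarith

/-- One ball of radius `R / M` covers `E ∩ closedBall x R`, whereas a positive exponent `a` would
require at least `C * M ^ a` balls. -/
theorem HasGaps.lowerDim_eq_zero {X : Type*} [MetricSpace X] {E : Set X} (hE : HasGaps E)
    (hne : E.Nonempty) : lowerDim E = 0 := by
  obtain ⟨x, hx⟩ := hne
  simp only [lowerDim, ENNReal.iSup_eq_zero]
  rintro a ⟨ha, C, hC, h⟩
  exfalso
  have ha' : (0 : ℝ) < a := ha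
  obtain ⟨M, hM⟩ := ((tendsto_rpow_atTop ha').eventually_gt_atTop ((C : ℝ)⁻¹)).and
    (eventually_ge_atTop 1) |>.exists
  obtain ⟨R, hR0, hR1, hR⟩ := hE M hM.2 x hx
  have hM0 : 0 < M := one_pos.trans_le hM.2
  lift M to ℝ≥0 using hM0.le
  lift R to ℝ≥0 using hR0.le
  have hcov := h (R / M) R (div_pos (by exact_mod_cast hR0) (by exact_mod_cast hM0))
    (div_le_self zero_le (by exact_mod_cast hM.2)) (by exact_mod_cast hR1) x hx
  have hone : coveringNumber (R / M) (closedBall x R ∩ E) ≤ 1 := by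
    refine (IsCover.coveringNumber_le_encard (C := {x})
      (singleton_subset_iff.2 (mem_inter (mem_closedBall_self R.2) hx)) ?_).trans (by simp)
    rw [isCover_iff_subset_iUnion_closedBall]
    simp only [mem_singleton_iff, iUnion_iUnion_eq_left]
    intro y hy
    exact_mod_cast hR ⟨hy.2, hy.1⟩
  have h1 := hcov.trans (ENat.toENNReal_le.2 hone)
  rw [ENat.toENNReal_one] at h1
  have h2 : C * (R / (R / M)) ^ (a : ℝ) ≤ 1 := by exact_mod_cast h1
  have hRM : R / (R / M) = M := by
    have : R ≠ 0 := by rintro rfl; simp at hR0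
    have : M ≠ 0 := by rintro rfl; simp at hM0
    field_simp
  rw [hRM] at h2
  have h3 : (C : ℝ) * (M : ℝ) ^ (a : ℝ) ≤ 1 := by exact_mod_cast h2
  have hC' : (0 : ℝ) < C := hC
  have h4 := mul_lt_mul_of_pos_left hM.1 hC'
  rw [mul_inv_cancel₀ hC'.ne'] at h4
  linarith

theorem HasGaps.modifiedLowerDim_eq_zero {X : Type*} [MetricSpace X] {E : Set X}
    (hE : HasGaps E) : modifiedLowerDim E = 0 := by
  simp only [modifiedLowerDim, ENNReal.iSup_eq_zero]
  rintro F ⟨hne, hF⟩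
  exact (hE.mono hF).lowerDim_eq_zero hne

/-- The balls of radii `R` and `R / M` have equal mass, which regularity forbids once `M ^ s > C *
C`. As `R < 1`, both radii are admissible. -/
theorem HasGaps.not_isAhlforsDavidRegular {X : Type*} [MetricSpace X] [MeasurableSpace X]
    [BorelSpace X] {E : Set X} (hE : HasGaps E) {s : ℝ} (hs : 0 < s) :
    ¬ IsAhlforsDavidRegular s E := by
  rintro ⟨⟨x, hx⟩, μ, C, hC, hμ, h⟩
  obtain ⟨M, hM⟩ := ((tendsto_rpow_atTop hs).eventually_gt_atTop (C * C)).and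
    (eventually_ge_atTop 1) |>.exists
  obtain ⟨R, hR0, hR1, hR⟩ := hE M hM.2 x hx
  have hM0 : 0 < M := one_pos.trans_le hM.2
  have hle : ∀ r : ℝ, r ≤ 1 → ENNReal.ofReal r ≤ max 1 (ediam E) := fun r hr =>
    le_max_of_le_left (ENNReal.ofReal_le_one.2 hr)
  have h1 := (h x hx R hR0 (hle R hR1.le)).1
  have h2 := (h x hx (R / M) (by positivity)
    (hle _ ((div_le_self hR0.le hM.2).trans hR1.le))).2
  have h3 : μ (closedBall x R) ≤ μ (closedBall x (R / M)) := by
    calc μ (closedBall x R) ≤ μ (closedBall x (R / M) ∪ Eᶜ) := by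
          refine measure_mono fun y hy => ?_
          by_cases hyE : y ∈ E
          · exact Or.inl (hR ⟨hyE, hy⟩)
          · exact Or.inr hyE
      _ ≤ μ (closedBall x (R / M)) + μ Eᶜ := measure_union_le _ _
      _ = μ (closedBall x (R / M)) := by rw [hμ, add_zero]
  have h4 := (ENNReal.ofReal_le_ofReal_iff (by positivity)).1 (h1.trans (h3.trans h2))
  have hRs : 0 < R ^ s := Real.rpow_pos_of_pos hR0 s
  have hMs : 0 < M ^ s := Real.rpow_pos_of_pos hM0 s
  rw [Real.div_rpow hR0.le hM0.le, inv_mul_eq_div, ← mul_div_assoc,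
    div_le_div_iff₀ hC hMs] at h4
  nlinarith [hM.1]

/-! ### Covering numbers and Hausdorff versus Assouad dimension -/

theorem coveringNumber_le_card {X β : Type*} [MetricSpace X] [Fintype β] {r : ℝ≥0} {A : Set X}
    (f : X → β) (hf : ∀ x ∈ A, ∀ y ∈ A, f x = f y → dist x y ≤ r) :
    coveringNumber r A ≤ Fintype.card β := by
  rcases A.eq_empty_or_nonempty with rfl | ⟨x₀, -⟩
  · simp
  have : Nonempty X := ⟨x₀⟩
  choose! g hgA hgf using fun b (hb : b ∈ f '' A) => hb
  refine (IsCover.coveringNumber_le_encard (C := g '' (f '' A)) ?_ ?_).trans ?_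
  · rintro _ ⟨b, hb, rfl⟩
    exact hgA b hb
  · rw [isCover_iff_subset_iUnion_closedBall]
    intro x hx
    have hfx := mem_image_of_mem f hx
    exact mem_biUnion (mem_image_of_mem g hfx) (hf x hx _ (hgA _ hfx) (hgf _ hfx).symm)
  · refine (encard_image_le _ _).trans ((encard_le_encard (subset_univ _)).trans ?_)
    rw [encard_univ, ENat.card_eq_coe_fintype_card]

/-- Compactness reduces to finitely many pieces of radius `1 / 2`. Each is covered by at most `C *
(2 ^ n) ^ a` sets of diameter at most `2 ^ (-n)`, so its `a`-dimensional Hausdorff measure is at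
most `C`. -/
theorem IsCompact.dimH_le_assouadDim {X : Type*} [MetricSpace X] {K : Set X} (hK : IsCompact K) :
    dimH K ≤ assouadDim K := by
  borelize X
  simp only [assouadDim, le_iInf_iff]
  rintro a ⟨ha, C, hC, h⟩
  obtain ⟨t, htK, ht, hcov⟩ := hK.finite_cover_balls (e := 1 / 2) (by norm_num)
  have hKU : K ⊆ ⋃ x ∈ t, closedBall x (1 / 2 : ℝ) ∩ K := by
    intro y hy
    obtain ⟨x, hx, hyx⟩ := mem_iUnion₂.1 (hcov hy)
    exact mem_iUnion₂.2 ⟨x, hx, ball_subset_closedBall hyx, hy⟩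
  refine (dimH_mono hKU).trans ?_
  rw [dimH_bUnion ht.countable]
  refine iSup₂_le fun x hx => ?_
  set A : Set X := closedBall x (1 / 2 : ℝ) ∩ K with hA
  apply dimH_le_of_hausdorffMeasure_ne_top
  have hball : ∀ n : ℕ, ∃ D : Set X, D.Finite ∧ IsCover ((1 / 2 : ℝ≥0) ^ (n + 1)) A D ∧
      (D.encard : ℝ≥0∞) ≤ ((C * (2 ^ n) ^ (a : ℝ) : ℝ≥0) : ℝ≥0∞) := by
    intro n
    have h1 := h ((1 / 2 : ℝ≥0) ^ (n + 1)) (1 / 2) (by positivity)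
      (pow_le_of_le_one (by positivity) (by norm_num) (by simp)) (by
        rw [← NNReal.coe_lt_coe]; norm_num) x (htK hx)
    have hR : ((1 / 2 : ℝ≥0) : ℝ) = 1 / 2 := by norm_num
    rw [hR, ← hA] at h1
    have h2 : coveringNumber ((1 / 2 : ℝ≥0) ^ (n + 1)) A ≠ ⊤ := by
      intro h3
      rw [h3, ENat.toENNReal_top] at h1
      exact ENNReal.coe_ne_top (top_le_iff.1 h1)
    obtain ⟨D, hD⟩ := exists_set_encard_eq_coveringNumber h2
    refine ⟨D, hD.2.1, hD.2.2.1, ?_⟩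
    rw [hD.2.2.2]
    convert h1 using 4
    rw [pow_succ', div_mul_cancel_left₀ (by norm_num), one_div, inv_pow, inv_inv]
  choose D hDfin hDcov hDcard using hball
  have : ∀ n, Fintype (D n) := fun n => (hDfin n).fintype
  have key := Measure.hausdorffMeasure_le_liminf_sum (a : ℝ) A (l := atTop)
    (fun n : ℕ => ((2 * (1 / 2 : ℝ≥0) ^ (n + 1) : ℝ≥0) : ℝ≥0∞)) (by
      rw [← ENNReal.coe_zero, ENNReal.tendsto_coe]
      have := ((NNReal.tendsto_pow_atTop_nhds_zero_of_lt_one (r := (1 / 2 : ℝ≥0))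
        (by rw [← NNReal.coe_lt_coe]; norm_num)).comp (tendsto_add_atTop_nat 1)).const_mul 2
      simpa only [mul_zero, Function.comp_def] using this)
    (fun n (y : D n) => closedEBall (y : X) ((1 / 2 : ℝ≥0) ^ (n + 1) : ℝ≥0))
    (Eventually.of_forall fun n y => ediam_closedEBall_le.trans_eq (by
      rw [ENNReal.coe_mul, ENNReal.coe_ofNat]))
    (Eventually.of_forall fun n => by
      rw [iUnion_coe_set]
      exact isCover_iff_subset_iUnion_closedEBall.1 (hDcov n))
  refine (key.trans (?_ : _ ≤ (C : ℝ≥0∞))).trans_lt ENNReal.coe_lt_top |>.ne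
  refine liminf_le_of_le (by isBoundedDefault) fun b hb => ?_
  obtain ⟨n, hn⟩ := hb.exists
  refine hn.trans ?_
  calc ∑ y : D n, ediam (closedEBall (y : X) ((1 / 2 : ℝ≥0) ^ (n + 1) : ℝ≥0)) ^ (a : ℝ)
      ≤ ∑ y : D n, (((1 / 2 : ℝ≥0) ^ n : ℝ≥0) : ℝ≥0∞) ^ (a : ℝ) := by
        refine Finset.sum_le_sum fun y _ => ENNReal.rpow_le_rpow ?_ a.2
        refine ediam_closedEBall_le.trans (le_of_eq ?_)
        rw [← ENNReal.coe_ofNat, ← ENNReal.coe_mul]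
        congr 1
        rw [pow_succ]
        field_simp
    _ = ((D n).encard : ℝ≥0∞) * (((1 / 2 : ℝ≥0) ^ n : ℝ≥0) : ℝ≥0∞) ^ (a : ℝ) := by
        rw [Finset.sum_const, nsmul_eq_mul, Finset.card_univ, ← ENat.toENNReal_coe,
          ← ENat.card_eq_coe_fintype_card, ← encard]
    _ ≤ ((C * (2 ^ n) ^ (a : ℝ) : ℝ≥0) : ℝ≥0∞) * (((1 / 2 : ℝ≥0) ^ n : ℝ≥0) : ℝ≥0∞) ^ (a : ℝ) := by
        gcongr
        exact hDcard n
    _ = C := by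
        rw [← ENNReal.coe_rpow_of_nonneg _ a.coe_nonneg, ← ENNReal.coe_mul, mul_assoc, ← NNReal.mul_rpow,
          ← mul_pow]
        simp

/-! ### Dimension and gaps of binary-coded sets -/

/-- `Φ` parametrizes its range by families of binary sequences such that the distance of two points
is comparable to `δ n`, where `n` is the first position at which their codes differ. -/
structure IsBinaryCoding {X ι : Type*} [MetricSpace X] (Φ : (ι → ℕ → Fin 2) → X) (δ : ℕ → ℝ)
    (κ D : ℝ) : Prop where
  pos : ∀ n, 0 < δ n
  antitone : Antitone δ
  tendsto : Tendsto δ atTop (𝓝 0)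
  lower_pos : 0 < κ
  upper_pos : 0 < D
  dist_le : ∀ n ω ω', (∀ j, ∀ i < n, ω j i = ω' j i) → dist (Φ ω) (Φ ω') ≤ D * δ n
  eq_of_dist_lt : ∀ n ω ω', dist (Φ ω) (Φ ω') < κ * δ n → ∀ j, ∀ i ≤ n, ω j i = ω' j i

namespace IsBinaryCoding

variable {X ι : Type*} [MetricSpace X] {Φ : (ι → ℕ → Fin 2) → X} {δ : ℕ → ℝ} {κ D : ℝ}

theorem exists_mul_le (hΦ : IsBinaryCoding Φ δ κ D) (c : ℝ) {r : ℝ} (hr : 0 < r) :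
    ∃ n, c * δ n ≤ r := by
  have h := hΦ.tendsto.const_mul c
  rw [mul_zero] at h
  exact (h.eventually (ge_mem_nhds hr)).exists

/-- Take the first `n` with `κ * δ n ≤ R`; at each earlier index a disagreement would force distance
greater than `R`. -/
theorem exists_scale (hΦ : IsBinaryCoding Φ δ κ D) {R : ℝ} (hR : 0 < R) :
    ∃ n, κ * δ n ≤ R ∧
      ∀ ω ω', dist (Φ ω) (Φ ω') ≤ R → ∀ j, ∀ i < n, ω j i = ω' j i := by
  classical
  have hex := hΦ.exists_mul_le κ hR
  refine ⟨Nat.find hex, Nat.find_spec hex, fun ω ω' h j i hi => ?_⟩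
  have := Nat.find_min hex hi
  exact hΦ.eq_of_dist_lt i ω ω' (h.trans_lt (not_le.1 this)) j i le_rfl

theorem injective (hΦ : IsBinaryCoding Φ δ κ D) : Function.Injective Φ := by
  intro ω ω' h
  funext j i
  refine hΦ.eq_of_dist_lt i ω ω' ?_ j i le_rfl
  rw [h, dist_self]
  exact mul_pos hΦ.lower_pos (hΦ.pos i)

theorem coveringNumber_le [Fintype ι] (hΦ : IsBinaryCoding Φ δ κ D) {r : ℝ≥0} {A : Set X}
    (hA : A ⊆ range Φ) {n m : ℕ} (hm : D * δ m ≤ r)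
    (hn : ∀ ω ω', Φ ω ∈ A → Φ ω' ∈ A → ∀ j, ∀ i < n, ω j i = ω' j i) :
    coveringNumber r A ≤ (2 ^ (Fintype.card ι * (m - n)) : ℕ) := by
  classical
  have hcard : Fintype.card (ι → Fin (m - n) → Fin 2) = 2 ^ (Fintype.card ι * (m - n)) := by
    rw [mul_comm, pow_mul]
    simp
  rw [← hcard]
  refine coveringNumber_le_card
    (fun x j i => Function.invFun Φ x j (n + i)) fun x hx y hy hxy => ?_
  obtain ⟨ω, rfl⟩ := hA hx
  obtain ⟨ω', rfl⟩ := hA hy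
  simp only [Function.leftInverse_invFun hΦ.injective _] at hxy
  refine (hΦ.dist_le m ω ω' fun j i hi => ?_).trans hm
  rcases lt_or_ge i n with h | h
  · exact hn ω ω' hx hy j i h
  · have := congrFun (congrFun hxy j) ⟨i - n, by omega⟩
    simpa [Nat.add_sub_cancel' h] using this

theorem assouadDim_range_le [Fintype ι] (hΦ : IsBinaryCoding Φ δ κ D) {a : ℝ≥0}
    (h : ∀ t : ℝ, a < t → ∃ C : ℝ, 0 < C ∧
      ∀ n k, (2 : ℝ) ^ (Fintype.card ι * k) ≤ C * (δ n / δ (n + k)) ^ t) :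
    assouadDim (range Φ) ≤ a := by
  classical
  have hκ := hΦ.lower_pos
  have hD := hΦ.upper_pos
  refine le_of_forall_gt_imp_ge_of_dense fun b hb => ?_
  obtain ⟨t, hat, htb⟩ := ENNReal.lt_iff_exists_nnreal_btwn.1 hb
  refine le_trans ?_ htb.le
  rw [ENNReal.coe_lt_coe] at hat
  obtain ⟨C, hC, hCt⟩ := h t (by exact_mod_cast hat)
  -- The `1` serves the case `m ≤ n`, where one ball suffices; the factor `2 ^ Fintype.card ι` pays
  -- for the last digit, since minimality of `m` bounds `r` only by `D * δ (m - 1)`.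
  set C' : ℝ := max 1 (2 ^ Fintype.card ι * C * (D / κ) ^ (t : ℝ))
  have hC'0 : 0 < C' := one_pos.trans_le (le_max_left _ _)
  refine iInf₂_le t ⟨(zero_le (a := a)).trans_lt hat, ⟨C', hC'0.le⟩, hC'0, ?_⟩
  rintro r R hr hrR - x ⟨ω₀, rfl⟩
  have hr' : (0 : ℝ) < r := hr
  have hrR' : (r : ℝ) ≤ R := hrR
  have hR' : (0 : ℝ) < R := hr'.trans_le hrR'
  obtain ⟨n, hnR, hn⟩ := hΦ.exists_scale hR'
  have hex := hΦ.exists_mul_le D hr'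
  have hm := Nat.find_spec hex
  set m := Nat.find hex
  have hcov := hΦ.coveringNumber_le (A := closedBall (Φ ω₀) R ∩ range Φ) inter_subset_right hm
    (n := n) (fun ω ω' hω hω' j i hi =>
      (hn ω ω₀ hω.1 j i hi).trans (hn ω' ω₀ hω'.1 j i hi).symm)
  refine (ENat.toENNReal_le.2 hcov).trans ?_
  rw [ENat.toENNReal_coe, ← ENNReal.coe_natCast, ENNReal.coe_le_coe, ← NNReal.coe_le_coe]
  push_cast
  have hratio : 1 ≤ (R / r : ℝ) ^ (t : ℝ) :=
    Real.one_le_rpow ((one_le_div hr').2 hrR') t.coe_nonneg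
  rcases le_or_gt m n with hmn | hmn
  · rw [Nat.sub_eq_zero_of_le hmn, mul_zero, pow_zero]
    exact one_le_mul_of_one_le_of_one_le (le_max_left _ _) hratio
  · obtain ⟨k, hk⟩ := Nat.exists_eq_add_of_lt hmn
    have hrk : (r : ℝ) < D * δ (n + k) := not_le.1 (Nat.find_min hex (by omega))
    have hk' : m - n = k + 1 := by omega
    have hq : δ n / δ (n + k) ≤ D / κ * (R / r) := by
      rw [div_mul_div_comm, div_le_div_iff₀ (hΦ.pos _) (by positivity)]
      have := mul_le_mul hnR hrk.le hr'.le hR'.le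
      linarith
    calc (2 : ℝ) ^ (Fintype.card ι * (m - n))
        = 2 ^ Fintype.card ι * 2 ^ (Fintype.card ι * k) := by rw [hk', mul_add_one, pow_add, mul_comm]
      _ ≤ 2 ^ Fintype.card ι * (C * (D / κ * (R / r)) ^ (t : ℝ)) := by
          gcongr
          refine (hCt n k).trans ?_
          gcongr
          exact div_nonneg (hΦ.pos _).le (hΦ.pos _).le
      _ = 2 ^ Fintype.card ι * C * (D / κ) ^ (t : ℝ) * (R / r : ℝ) ^ (t : ℝ) := by
          rw [Real.mul_rpow (by positivity) (by positivity)]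
          ring
      _ ≤ C' * (R / r : ℝ) ^ (t : ℝ) := by
          gcongr
          exact le_max_right _ _

/-- Points within less than `κ * δ m` share all digits through `m`, hence lie within `D * δ (m +
1)`; a jump after `m` turns this into a gap. If `δ n` is much smaller than `R`, the ball of radius
`R` already shows one; otherwise `δ n` is comparable to `R`. -/
theorem uniformlyGapped_range (hΦ : IsBinaryCoding Φ δ κ D)
    (h : ∀ M : ℝ, 1 ≤ M → ∃ ρ : ℝ, 0 < ρ ∧
      ∀ n, ∃ m, n ≤ m ∧ M * δ (m + 1) ≤ δ m ∧ ρ * δ n ≤ δ m) :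
    UniformlyGapped (range Φ) := by
  intro M hM
  have hκ := hΦ.lower_pos
  have hD := hΦ.upper_pos
  have hM0 : 0 < M := one_pos.trans_le hM
  -- This ratio gives `D * δ (m + 1) ≤ κ * δ m / 2 / M`.
  obtain ⟨ρ, hρ, hρn⟩ := h (max 1 (2 * M * D / κ)) (le_max_left _ _)
  refine ⟨min 1 (κ * ρ / (2 * M * D)), lt_min one_pos (by positivity), ?_⟩
  rintro _ ⟨ω, rfl⟩ R hR -
  obtain ⟨n, hnR, hn⟩ := hΦ.exists_scale hR
  rcases le_or_gt (D * δ n) (R / M) with hcase | hcase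
  · refine ⟨R, mul_le_of_le_one_left hR.le (min_le_left _ _), le_rfl, ?_⟩
    rintro _ ⟨⟨ω', rfl⟩, hω'⟩
    exact (hΦ.dist_le n _ _ (hn _ _ hω')).trans hcase
  · obtain ⟨m, hnm, hm, hρm⟩ := hρn n
    have hδm := hΦ.pos m
    refine ⟨κ * δ m / 2, ?_, ?_, ?_⟩
    · calc min 1 (κ * ρ / (2 * M * D)) * R ≤ κ * ρ / (2 * M * D) * R := by
            gcongr
            exact min_le_right _ _
        _ = κ * ρ / (2 * D) * (R / M) := by field_simp
        _ ≤ κ * ρ / (2 * D) * (D * δ n) := by gcongr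
        _ = κ * (ρ * δ n) / 2 := by field_simp
        _ ≤ κ * δ m / 2 := by gcongr
    · have : κ * δ m ≤ κ * δ n := mul_le_mul_of_nonneg_left (hΦ.antitone hnm) hκ.le
      have := mul_pos hκ hδm
      linarith
    · rintro _ ⟨⟨ω', rfl⟩, hω'⟩
      have hlt : dist (Φ ω') (Φ ω) < κ * δ m :=
        (mem_closedBall.1 hω').trans_lt (half_lt_self (mul_pos hκ hδm))
      have h1 := hΦ.dist_le (m + 1) ω' ω fun j i hi =>
        hΦ.eq_of_dist_lt m ω' ω hlt j i (Nat.lt_succ_iff.1 hi)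
      refine h1.trans ?_
      have h2 : 2 * M * D / κ * δ (m + 1) ≤ δ m :=
        (mul_le_mul_of_nonneg_right (le_max_right _ _) (hΦ.pos _).le).trans hm
      calc D * δ (m + 1) = κ / (2 * M) * (2 * M * D / κ * δ (m + 1)) := by field_simp
        _ ≤ κ / (2 * M) * δ m := by gcongr
        _ = κ * δ m / 2 / M := by field_simp

/-- Reading codes as binary expansions maps the range onto a set containing an open cube. The map is
`s`-Hölder: agreement of `n` digits gives distance at most `2 ^ (-n) ≤ δ n ^ s`. -/
theorem le_dimH_range [Fintype ι] (hΦ : IsBinaryCoding Φ δ κ D) {s : ℝ≥0} (hs : 0 < s)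
    (h : ∀ n, ((2 : ℝ) ^ n)⁻¹ ≤ δ n ^ (s : ℝ)) :
    Fintype.card ι * s ≤ dimH (range Φ) := by
  have hκ := hΦ.lower_pos
  set f : X → ι → ℝ := fun x j => Real.ofDigits (Function.invFun Φ x j) with hf
  have hfΦ : ∀ ω, f (Φ ω) = fun j => Real.ofDigits (ω j) := fun ω => by
    simp only [hf, Function.leftInverse_invFun hΦ.injective ω]
  have hholder : HolderOnWith (κ⁻¹.toNNReal ^ (s : ℝ)) s f (range Φ) := by
    rintro _ ⟨ω, rfl⟩ _ ⟨ω', rfl⟩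
    rw [edist_nndist, edist_nndist, ← ENNReal.coe_rpow_of_nonneg _ s.coe_nonneg, ← ENNReal.coe_mul,
      ENNReal.coe_le_coe, ← NNReal.coe_le_coe]
    push_cast
    rw [Real.coe_toNNReal _ (inv_pos.2 hκ).le, ← Real.mul_rpow (inv_pos.2 hκ).le dist_nonneg]
    rcases (dist_nonneg (x := Φ ω) (y := Φ ω')).eq_or_lt with h0 | h0
    · rw [dist_eq_zero.1 h0.symm, dist_self, dist_self]
      exact Real.rpow_nonneg (by simp) _
    · obtain ⟨n, hn, hagree⟩ := hΦ.exists_scale h0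
      refine (dist_pi_le_iff (Real.rpow_nonneg (by positivity) _)).2 fun j => ?_
      rw [hfΦ, hfΦ, Real.dist_eq]
      refine (Real.abs_ofDigits_sub_ofDigits_le (hagree ω ω' le_rfl j)).trans ?_
      refine (by exact_mod_cast h n : _ ≤ δ n ^ (s : ℝ)).trans ?_
      refine Real.rpow_le_rpow (hΦ.pos n).le ?_ s.coe_nonneg
      rwa [inv_mul_eq_div, le_div_iff₀' hκ]
  have hsub : ball (fun _ : ι => (1 / 2 : ℝ)) (1 / 2) ⊆ f '' range Φ := by
    intro y hy
    have hy' : ∀ j, ∃ x : ℕ → Fin 2, Real.ofDigits x = y j := fun j => by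
      have := (dist_le_pi_dist y _ j).trans_lt (mem_ball.1 hy)
      rw [Real.dist_eq, abs_lt] at this
      obtain ⟨x, -, hx⟩ := Real.ofDigits_SurjOn one_lt_two
        (show y j ∈ Icc (0 : ℝ) 1 from ⟨by linarith, by linarith⟩)
      exact ⟨x, hx⟩
    choose ω hω using hy'
    exact ⟨Φ ω, mem_range_self ω, by rw [hfΦ]; exact funext hω⟩
  have hdim := (dimH_mono hsub).trans (hholder.dimH_image_le hs)
  rw [Real.dimH_ball_pi _ (by norm_num)] at hdim
  rwa [ENNReal.le_div_iff_mul_le (Or.inl (by exact_mod_cast hs.ne')) (Or.inl ENNReal.coe_ne_top)]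
    at hdim

end IsBinaryCoding

/-! ### Cantor sets and their products -/

/-- The point `∑ xᵢ δᵢ` of the Cantor set with gap scales `δᵢ`. -/
noncomputable def cantorPoint (δ : ℕ → ℝ) (x : ℕ → Fin 2) : ℝ := ∑' i, (x i : ℝ) * δ i

section CantorPoint

variable {δ : ℕ → ℝ} {θ : ℝ}

theorem le_pow_mul_of_le_mul (hθ0 : 0 ≤ θ) (hδ : ∀ n, δ (n + 1) ≤ θ * δ n) (n k : ℕ) :
    δ (n + k) ≤ θ ^ k * δ n := by
  induction k with
  | zero => simp
  | succ k ih =>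
    calc δ (n + (k + 1)) ≤ θ * δ (n + k) := hδ (n + k)
      _ ≤ θ * (θ ^ k * δ n) := by gcongr
      _ = θ ^ (k + 1) * δ n := by ring

theorem hasSum_pow_mul (hθ0 : 0 ≤ θ) (hθ1 : θ < 1) (c : ℝ) :
    HasSum (fun k : ℕ => θ ^ k * c) (c / (1 - θ)) := by
  have := (hasSum_geometric_of_lt_one hθ0 hθ1).mul_right c
  rwa [inv_mul_eq_div] at this

theorem summable_cantorPoint (hpos : ∀ n, 0 < δ n) (hθ0 : 0 ≤ θ) (hθ1 : θ < 1)
    (hδ : ∀ n, δ (n + 1) ≤ θ * δ n) (x : ℕ → Fin 2) : Summable fun i => (x i : ℝ) * δ i := by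
  refine Summable.of_nonneg_of_le (fun i => mul_nonneg (by positivity) (hpos i).le) (fun i => ?_)
    (hasSum_pow_mul hθ0 hθ1 (δ 0)).summable
  have h1 : ((x i : ℕ) : ℝ) ≤ 1 := by exact_mod_cast Nat.lt_succ_iff.1 (x i).2
  have h2 := le_pow_mul_of_le_mul hθ0 hδ 0 i
  rw [zero_add] at h2
  exact (mul_le_of_le_one_left (hpos i).le h1).trans h2

theorem abs_cantorPoint_sub_le (hpos : ∀ n, 0 < δ n) (hθ0 : 0 ≤ θ) (hθ1 : θ < 1)
    (hδ : ∀ n, δ (n + 1) ≤ θ * δ n) {x y : ℕ → Fin 2} {n : ℕ} (h : ∀ i < n, x i = y i) :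
    |cantorPoint δ x - cantorPoint δ y| ≤ δ n / (1 - θ) := by
  have hx := summable_cantorPoint hpos hθ0 hθ1 hδ x
  have hy := summable_cantorPoint hpos hθ0 hθ1 hδ y
  rw [cantorPoint, cantorPoint, ← hx.tsum_sub hy, ← (hx.sub hy).sum_add_tsum_nat_add n,
    Finset.sum_eq_zero (fun i hi => by rw [h i (Finset.mem_range.1 hi), sub_self]), zero_add,
    ← Real.norm_eq_abs]
  refine tsum_of_norm_bounded (hasSum_pow_mul hθ0 hθ1 (δ n)) fun i => ?_
  rw [← sub_mul, norm_mul, Real.norm_of_nonneg (hpos _).le, add_comm i n]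
  refine le_trans ?_ (le_pow_mul_of_le_mul hθ0 hδ n i)
  refine mul_le_of_le_one_left (hpos _).le ?_
  have h1 : ∀ a : Fin 2, 0 ≤ (a : ℝ) ∧ (a : ℝ) ≤ 1 := fun a =>
    ⟨by positivity, by exact_mod_cast Nat.lt_succ_iff.1 a.2⟩
  rw [Real.norm_eq_abs, abs_le]
  constructor <;> linarith [h1 (x (n + i)), h1 (y (n + i))]

/-- Switching digit `n` alone moves the point by exactly `δ n`; the later digits recover at most `θ
* δ n / (1 - θ)`. -/
theorem le_abs_cantorPoint_sub (hpos : ∀ n, 0 < δ n) (hθ0 : 0 ≤ θ) (hθ1 : θ < 1)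
    (hδ : ∀ n, δ (n + 1) ≤ θ * δ n) {x y : ℕ → Fin 2} {n : ℕ} (h : ∀ i < n, x i = y i)
    (hne : x n ≠ y n) :
    (1 - θ / (1 - θ)) * δ n ≤ |cantorPoint δ x - cantorPoint δ y| := by
  classical
  set z := Function.update x n (y n) with hz
  have hx := summable_cantorPoint hpos hθ0 hθ1 hδ x
  have hzs := summable_cantorPoint hpos hθ0 hθ1 hδ z
  have h1 : |cantorPoint δ z - cantorPoint δ y| ≤ θ * δ n / (1 - θ) := by
    refine (abs_cantorPoint_sub_le hpos hθ0 hθ1 hδ (n := n + 1) fun i hi => ?_).trans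
      (div_le_div_of_nonneg_right (hδ n) (by linarith))
    rcases (Nat.lt_succ_iff.1 hi).eq_or_lt with rfl | hi
    · simp [hz]
    · simp [hz, hi.ne, h i hi]
  have h2 : cantorPoint δ x - cantorPoint δ z = ((x n : ℝ) - y n) * δ n := by
    rw [cantorPoint, cantorPoint, ← hx.tsum_sub hzs, tsum_eq_single n]
    · simp [hz, sub_mul]
    · intro i hi
      simp [hz, hi]
  have h3 : |((x n : ℕ) : ℝ) - (y n : ℕ)| = 1 := by
    generalize x n = a at hne
    generalize y n = b at hne
    fin_cases a <;> fin_cases b <;> simp_all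
  have h4 : |cantorPoint δ x - cantorPoint δ z| = δ n := by
    rw [h2, abs_mul, h3, one_mul, abs_of_pos (hpos n)]
  have h5 := abs_sub_le (cantorPoint δ x) (cantorPoint δ y) (cantorPoint δ z)
  rw [abs_sub_comm (cantorPoint δ y)] at h5
  have h6 : (1 - θ / (1 - θ)) * δ n = δ n - θ * δ n / (1 - θ) := by ring
  linarith

theorem continuous_cantorPoint (hpos : ∀ n, 0 < δ n) (hθ0 : 0 ≤ θ) (hθ1 : θ < 1)
    (hδ : ∀ n, δ (n + 1) ≤ θ * δ n) : Continuous (cantorPoint δ) := by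
  refine continuous_tsum (fun i => ?_) (hasSum_pow_mul hθ0 hθ1 (δ 0)).summable fun i x => ?_
  · exact (continuous_of_discreteTopology (f := fun a : Fin 2 => (a : ℝ) * δ i)).comp
      (continuous_apply i)
  · have h1 : ((x i : ℕ) : ℝ) ≤ 1 := by exact_mod_cast Nat.lt_succ_iff.1 (x i).2
    have h2 := le_pow_mul_of_le_mul hθ0 hδ 0 i
    rw [zero_add] at h2
    rw [Real.norm_of_nonneg (mul_nonneg (by positivity) (hpos i).le)]
    exact (mul_le_of_le_one_left (hpos i).le h1).trans h2

/-- The point of the `d`-fold product of a Cantor set with the given codes as coordinates. -/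
noncomputable def cantorProductPoint (δ : ℕ → ℝ) {d : ℕ} (ω : Fin d → ℕ → Fin 2) :
    EuclideanSpace ℝ (Fin d) :=
  WithLp.toLp 2 fun j => cantorPoint δ (ω j)

theorem continuous_cantorProductPoint (hpos : ∀ n, 0 < δ n) (hθ0 : 0 ≤ θ) (hθ1 : θ < 1)
    (hδ : ∀ n, δ (n + 1) ≤ θ * δ n) (d : ℕ) : Continuous (cantorProductPoint δ (d := d)) := by
  refine (PiLp.continuous_toLp 2 _).comp (continuous_pi fun j => ?_)
  exact (continuous_cantorPoint hpos hθ0 hθ1 hδ).comp (continuous_apply j)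

theorem isBinaryCoding_cantorProductPoint (hpos : ∀ n, 0 < δ n) (hθ0 : 0 ≤ θ) (hθ1 : θ < 1 / 2)
    (hδ : ∀ n, δ (n + 1) ≤ θ * δ n) (d : ℕ) :
    IsBinaryCoding (cantorProductPoint δ (d := d)) δ (1 - θ / (1 - θ)) ((d + 1) / (1 - θ)) := by
  have hθ : 0 < 1 - θ := by linarith
  have hκ : 0 < 1 - θ / (1 - θ) := by
    rw [sub_pos, div_lt_one hθ]
    linarith
  have hanti : Antitone δ := antitone_nat_of_succ_le fun n =>
    (hδ n).trans (mul_le_of_le_one_left (hpos n).le (by linarith))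
  refine ⟨hpos, hanti, ?_, hκ, by positivity, fun n ω ω' h => ?_, fun n ω ω' h j i hi => ?_⟩
  · refine squeeze_zero (fun n => (hpos n).le) (fun n => ?_)
      (hasSum_pow_mul hθ0 (by linarith) (δ 0)).summable.tendsto_atTop_zero
    simpa using le_pow_mul_of_le_mul hθ0 hδ 0 n
  -- The factor `d + 1` is a crude substitute for `√d` that stays positive when `d = 0`.
  · rw [EuclideanSpace.dist_eq]
    refine Real.sqrt_le_iff.2 ⟨by have := hpos n; positivity, ?_⟩
    have hle : ∀ j ∈ Finset.univ, dist (cantorProductPoint δ ω j) (cantorProductPoint δ ω' j) ^ 2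
        ≤ (δ n / (1 - θ)) ^ 2 := fun j _ => by
      gcongr
      exact abs_cantorPoint_sub_le hpos hθ0 (by linarith) hδ (h j)
    refine (Finset.sum_le_card_nsmul _ _ _ hle).trans ?_
    rw [Finset.card_univ, Fintype.card_fin, nsmul_eq_mul,
      show ((d : ℝ) + 1) / (1 - θ) * δ n = (d + 1) * (δ n / (1 - θ)) by ring, mul_pow]
    gcongr
    nlinarith [(Nat.cast_nonneg d : (0 : ℝ) ≤ d)]
  · by_contra hne
    classical
    -- The separation estimate needs the first disagreement in coordinate `j`; it occurs no later
    -- than `n`, where `δ` is at least `δ n`.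
    have hex : ∃ i, ω j i ≠ ω' j i := ⟨i, hne⟩
    have h1 := le_abs_cantorPoint_sub hpos hθ0 (by linarith) hδ
      (fun k hk => not_not.1 (Nat.find_min hex hk)) (Nat.find_spec hex)
    have h2 : |cantorPoint δ (ω j) - cantorPoint δ (ω' j)| ≤
        dist (cantorProductPoint δ ω) (cantorProductPoint δ ω') := by
      have := PiLp.norm_apply_le (cantorProductPoint δ ω - cantorProductPoint δ ω') j
      rwa [← dist_eq_norm] at this
    have h3 : δ n ≤ δ (Nat.find hex) := hanti ((Nat.find_min' hex hne).trans hi)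
    have h4 := mul_le_mul_of_nonneg_left h3 hκ.le
    linarith

end CantorPoint

/-! ### Scales with recurring large jumps -/

section Scales

theorem padicValNat_factorial_add_le (n k : ℕ) :
    padicValNat 2 n.factorial + padicValNat 2 k.factorial ≤ padicValNat 2 (n + k).factorial := by
  have hpos : (n + k).choose k ≠ 0 := (Nat.choose_pos (Nat.le_add_left k n)).ne'
  rw [← Nat.add_choose_mul_factorial_mul_factorial n k,
    padicValNat.mul (mul_ne_zero hpos n.factorial_ne_zero) k.factorial_ne_zero,
    padicValNat.mul hpos n.factorial_ne_zero]
  omega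

theorem padicValNat_factorial_succ (n : ℕ) :
    padicValNat 2 (n + 1).factorial = padicValNat 2 n.factorial + padicValNat 2 (n + 1) := by
  rw [Nat.factorial_succ, padicValNat.mul (by omega) n.factorial_ne_zero, add_comm]

/-- By Legendre's formula `n - v₂(n!)` is the binary digit sum of `n`, at most its number of digits.
-/
theorem le_padicValNat_two_factorial_add_log (n : ℕ) :
    n ≤ padicValNat 2 n.factorial + (Nat.log 2 n + 1) := by
  rcases eq_or_ne n 0 with rfl | hn
  · simp
  have h1 := sub_one_mul_padicValNat_factorial (p := 2) n
  have h2 : (Nat.digits 2 n).sum ≤ (Nat.digits 2 n).length • 1 :=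
    List.sum_le_card_nsmul _ _ fun x hx => Nat.lt_succ_iff.1 (Nat.digits_lt_base one_lt_two hx)
  rw [Nat.length_digits _ _ one_lt_two hn, smul_eq_mul] at h2
  omega

theorem natLog_two_add_one_le {η : ℝ} (hη : 0 < η) :
    ∃ c : ℝ, ∀ n : ℕ, (Nat.log 2 n + 1 : ℝ) ≤ η * n + c := by
  have hl : 0 < Real.log 2 := Real.log_pos one_lt_two
  -- With this `a`, the inequality `log x ≤ x - 1` at `x = a * n` bounds `logb 2 n` with slope
  -- exactly `η`.
  set a := η * Real.log 2 with ha
  have ha0 : 0 < a := by positivity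
  refine ⟨max 1 (-Real.log a / Real.log 2 + 1), fun n => ?_⟩
  rcases Nat.eq_zero_or_pos n with rfl | hn
  · simp
  have hn' : (0 : ℝ) < n := by exact_mod_cast hn
  have h1 := Real.natLog_le_logb n 2
  have h2 := Real.log_le_sub_one_of_pos (mul_pos ha0 hn')
  rw [Real.log_mul ha0.ne' hn'.ne'] at h2
  have h3 : Real.logb 2 n ≤ η * n + -Real.log a / Real.log 2 := by
    rw [Real.logb, div_le_iff₀ hl, add_mul, div_mul_cancel₀ _ hl.ne']
    nlinarith
  have h4 := le_max_right 1 (-Real.log a / Real.log 2 + 1)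
  push_cast at h1
  linarith

/-- Scales decaying on average like `2 ^ (-(β + ε) n)`, with large jumps `δ n / δ (n + 1)`
whenever `n + 1` is divisible by a large power of two. -/
noncomputable def jumpScale (β ε : ℝ) (n : ℕ) : ℝ :=
  2 ^ (-(β * n + ε * padicValNat 2 n.factorial))

variable {β ε : ℝ}

theorem jumpScale_pos (n : ℕ) : 0 < jumpScale β ε n := Real.rpow_pos_of_pos two_pos _

theorem jumpScale_succ (n : ℕ) :
    jumpScale β ε (n + 1) = 2 ^ (-(β + ε * padicValNat 2 (n + 1))) * jumpScale β ε n := by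
  rw [jumpScale, jumpScale, ← Real.rpow_add two_pos, padicValNat_factorial_succ]
  push_cast
  ring_nf

theorem jumpScale_succ_le (hε : 0 ≤ ε) (n : ℕ) :
    jumpScale β ε (n + 1) ≤ 2 ^ (-β) * jumpScale β ε n := by
  rw [jumpScale_succ]
  refine mul_le_mul_of_nonneg_right ?_ (jumpScale_pos n).le
  refine Real.rpow_le_rpow_of_exponent_le one_le_two ?_
  have : 0 ≤ ε * padicValNat 2 (n + 1) := by positivity
  linarith

theorem inv_two_pow_le_jumpScale_rpow {s : ℝ} (hε : 0 ≤ ε) (hs : 0 ≤ s) (h : s * (β + ε) = 1)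
    (n : ℕ) : ((2 : ℝ) ^ n)⁻¹ ≤ jumpScale β ε n ^ s := by
  rw [jumpScale, ← Real.rpow_mul two_pos.le, ← Real.rpow_natCast, ← Real.rpow_neg two_pos.le]
  refine Real.rpow_le_rpow_of_exponent_le one_le_two ?_
  have h1 : (padicValNat 2 n.factorial : ℝ) ≤ n := by exact_mod_cast padicValNat_factorial_le 2 n
  have h2 := mul_le_mul_of_nonneg_left h1 (mul_nonneg hs hε)
  have h3 : (n : ℝ) = s * (β + ε) * n := by rw [h, one_mul]
  nlinarith

/-- By superadditivity the ratio has exponent at least `β k + ε v₂(k!)`, independently of `n`. This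
falls short of `(β + ε) k` only logarithmically, and the excess of `t * (β + ε)` over `d` absorbs
the loss. -/
theorem two_pow_le_jumpScale_div_rpow (hε : 0 < ε) {d : ℕ} {t : ℝ} (ht : 0 < t)
    (hdt : d < t * (β + ε)) :
    ∃ C : ℝ, 0 < C ∧
      ∀ n k, (2 : ℝ) ^ (d * k) ≤ C * (jumpScale β ε n / jumpScale β ε (n + k)) ^ t := by
  obtain ⟨c, hc⟩ := natLog_two_add_one_le (η := (t * (β + ε) - d) / (t * ε))
    (div_pos (by linarith) (by positivity))
  refine ⟨2 ^ (t * ε * c), Real.rpow_pos_of_pos two_pos _, fun n k => ?_⟩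
  rw [jumpScale, jumpScale, ← Real.rpow_sub two_pos, ← Real.rpow_mul two_pos.le,
    ← Real.rpow_add two_pos, ← Real.rpow_natCast]
  refine Real.rpow_le_rpow_of_exponent_le one_le_two ?_
  have h1 : (padicValNat 2 n.factorial + padicValNat 2 k.factorial : ℝ)
    ≤ padicValNat 2 (n + k).factorial := by exact_mod_cast padicValNat_factorial_add_le n k
  have h2 : (k : ℝ) ≤ padicValNat 2 k.factorial + (Nat.log 2 k + 1) := by
    exact_mod_cast le_padicValNat_two_factorial_add_log k
  have h3 := mul_le_mul_of_nonneg_left (hc k) (by positivity : 0 ≤ t * ε)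
  have h4 : t * ε * ((t * (β + ε) - d) / (t * ε) * k + c)
      = (t * (β + ε) - d) * k + t * ε * c := by field_simp
  have h5 := mul_le_mul_of_nonneg_left h1 (by positivity : 0 ≤ t * ε)
  have h6 := mul_le_mul_of_nonneg_left h2 (by positivity : 0 ≤ t * ε)
  push_cast
  rw [h4] at h3
  nlinarith

theorem exists_jump_near (hε : 0 < ε) (hβ : 0 ≤ β) (M : ℝ) :
    ∃ L, ∀ n, ∃ i ≤ L, M * jumpScale β ε (n + i + 1) ≤ jumpScale β ε (n + i) := by
  obtain ⟨q, hq⟩ := ((tendsto_rpow_atTop_of_base_gt_one 2 one_lt_two).comp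
    (tendsto_natCast_atTop_atTop.const_mul_atTop hε)).eventually_ge_atTop M |>.exists
  -- This `i` makes `n + i + 1` the first multiple of `2 ^ q` beyond `n`, so the jump there is at
  -- least `2 ^ (ε * q) ≥ M`.
  refine ⟨2 ^ q, fun n => ⟨2 ^ q * (n / 2 ^ q + 1) - (n + 1), ?_, ?_⟩⟩
  · have := Nat.div_mul_le_self n (2 ^ q)
    rw [mul_add_one, mul_comm]
    generalize 2 ^ q = N at this ⊢
    omega
  · have hlt := Nat.lt_mul_div_succ n (show 0 < 2 ^ q by positivity)
    set m := n + (2 ^ q * (n / 2 ^ q + 1) - (n + 1)) with hm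
    have hm1 : m + 1 = 2 ^ q * (n / 2 ^ q + 1) := by omega
    have hv : q ≤ padicValNat 2 (m + 1) :=
      (padicValNat_dvd_iff_le (by omega)).1 ⟨_, hm1⟩
    rw [jumpScale_succ, ← mul_assoc]
    refine mul_le_of_le_one_left (jumpScale_pos m).le ?_
    rw [Real.rpow_neg two_pos.le, ← div_eq_mul_inv, div_le_one (Real.rpow_pos_of_pos two_pos _)]
    refine (le_trans hq ?_)
    refine Real.rpow_le_rpow_of_exponent_le one_le_two ?_
    have : (q : ℝ) ≤ padicValNat 2 (m + 1) := by exact_mod_cast hv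
    have := mul_le_mul_of_nonneg_left this hε.le
    linarith

/-- If large jumps occur with bounded gaps, then from every scale one reaches a large jump after
losing at most a bounded factor. -/
theorem exists_comparable_jump {δ : ℕ → ℝ} (hpos : ∀ n, 0 < δ n) {M : ℝ} (hM : 1 ≤ M) (L n : ℕ)
    (h : ∃ i ≤ L, M * δ (n + i + 1) ≤ δ (n + i)) :
    ∃ m, n ≤ m ∧ M * δ (m + 1) ≤ δ m ∧ (M⁻¹) ^ L * δ n ≤ δ m := by
  have hM0 : 0 < M := one_pos.trans_le hM
  induction L generalizing n with
  | zero =>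
    obtain ⟨i, hi, hi'⟩ := h
    obtain rfl := Nat.le_zero.1 hi
    exact ⟨n, le_rfl, hi', by simp⟩
  | succ L ih =>
    by_cases hn : M * δ (n + 1) ≤ δ n
    · exact ⟨n, le_rfl, hn, mul_le_of_le_one_left (hpos n).le
        (pow_le_one₀ (by positivity) (inv_le_one_of_one_le₀ hM))⟩
    -- No jump at `n` means `M⁻¹ * δ n < δ (n + 1)`: moving on costs one factor `M⁻¹`.
    · obtain ⟨i, hi, hi'⟩ := h
      obtain ⟨m, hm, hm', hm''⟩ := ih (n + 1) (by
        rcases i with _ | i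
        · exact absurd hi' hn
        · exact ⟨i, by omega, by rwa [show n + 1 + i = n + (i + 1) by omega]⟩)
      refine ⟨m, by omega, hm', le_trans ?_ hm''⟩
      rw [pow_succ, mul_assoc]
      gcongr
      rw [inv_mul_le_iff₀ hM0]
      exact (not_le.1 hn).le

end Scales

/-! ### Choice of parameters and conclusion -/

theorem exists_uniformlyGapped_isCompact_dim_eq (d : ℕ) (α : ℝ) (hα : 0 < α) (hαd : α < d) :
    ∃ K : Set (EuclideanSpace ℝ (Fin d)), K.Nonempty ∧ IsCompact K ∧ UniformlyGapped K ∧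
      dimH K = ENNReal.ofReal α ∧ assouadDim K = ENNReal.ofReal α := by
  have hd : (0 : ℝ) < d := hα.trans hαd
  -- Here `β` is the midpoint of `1` and `d / α`: `β > 1` yields contraction below `1 / 2`, hence
  -- separation, and `ε > 0` yields the jumps. Both rest on `α < d`.
  set ε : ℝ := (d / α - 1) / 2 with hεdef
  set β : ℝ := (d / α + 1) / 2 with hβdef
  have hone : 1 < d / α := (one_lt_div hα).2 hαd
  have hε : 0 < ε := by linarith
  have hβ : 1 < β := by linarith
  have hβε : β + ε = d / α := by linarith
  have hθ : (2 : ℝ) ^ (-β) < 1 / 2 := by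
    calc (2 : ℝ) ^ (-β) < 2 ^ (-1 : ℝ) :=
          Real.rpow_lt_rpow_of_exponent_lt one_lt_two (by linarith)
      _ = 1 / 2 := by rw [Real.rpow_neg_one, one_div]
  have hθ0 : (0 : ℝ) ≤ 2 ^ (-β) := (Real.rpow_pos_of_pos two_pos _).le
  have hpos : ∀ n, 0 < jumpScale β ε n := jumpScale_pos
  have hcode := isBinaryCoding_cantorProductPoint hpos hθ0 hθ (jumpScale_succ_le hε.le) d
  have hcomp : IsCompact (range (cantorProductPoint (jumpScale β ε) (d := d))) :=
    isCompact_range (continuous_cantorProductPoint hpos hθ0 (by linarith)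
      (jumpScale_succ_le hε.le) d)
  have hupper : assouadDim (range (cantorProductPoint (jumpScale β ε) (d := d)))
      ≤ ENNReal.ofReal α := by
    refine hcode.assouadDim_range_le fun t ht => ?_
    rw [Real.coe_toNNReal _ hα.le] at ht
    rw [Fintype.card_fin]
    refine two_pow_le_jumpScale_div_rpow hε (hα.trans ht) ?_
    rw [hβε, ← mul_div_assoc, lt_div_iff₀ hα, mul_comm]
    exact mul_lt_mul_of_pos_right ht hd
  have hlower : ENNReal.ofReal α ≤ dimH (range (cantorProductPoint (jumpScale β ε) (d := d))) := by
    -- The Hölder exponent `α / d` satisfies `(α / d) * (β + ε) = 1`, and `d` coordinates give `d *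
    -- (α / d) = α`.
    have hs : 0 < (α / d).toNNReal := Real.toNNReal_pos.2 (by positivity)
    have hcoe : ((α / d).toNNReal : ℝ) = α / d := Real.coe_toNNReal _ (by positivity)
    convert hcode.le_dimH_range hs (inv_two_pow_le_jumpScale_rpow hε.le NNReal.zero_le_coe
      (by rw [hβε, hcoe]; field_simp)) using 1
    rw [Fintype.card_fin, ← ENNReal.ofReal_natCast d, ← ENNReal.ofReal,
      ← ENNReal.ofReal_mul hd.le]
    congr 1
    field_simp
  have hmid := hcomp.dimH_le_assouadDim
  refine ⟨_, range_nonempty _, hcomp, hcode.uniformlyGapped_range fun M hM => ?_,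
    le_antisymm (hmid.trans hupper) hlower, le_antisymm hupper (hlower.trans hmid)⟩
  obtain ⟨L, hL⟩ := exists_jump_near (β := β) hε (by linarith) M
  exact ⟨(M⁻¹) ^ L, by have := one_pos.trans_le hM; positivity,
    fun n => exists_comparable_jump hpos hM L n (hL n)⟩

theorem assouadDim_singleton {X : Type*} [MetricSpace X] (x : X) :
    assouadDim ({x} : Set X) = 0 := by
  refine nonpos_iff_eq_zero.1 (le_of_forall_gt_imp_ge_of_dense fun b hb => ?_)
  obtain ⟨t, ht0, htb⟩ := ENNReal.lt_iff_exists_nnreal_btwn.1 hb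
  refine le_trans ?_ htb.le
  refine iInf₂_le t ⟨by exact_mod_cast ht0, 1, one_pos, fun r R hr hrR _ y hy => ?_⟩
  have hsub : (closedBall y R ∩ {x}).Subsingleton := subsingleton_singleton.anti inter_subset_right
  have h1 : coveringNumber r (closedBall y R ∩ {x}) ≤ 1 :=
    coveringNumber_le_one_of_ediam_le (by rw [hsub.ediam_eq]; exact zero_le)
  refine (ENat.toENNReal_le.2 h1).trans ?_
  rw [ENat.toENNReal_one, one_mul]
  exact_mod_cast NNReal.one_le_rpow ((one_le_div hr).2 hrR) t.coe_nonneg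

theorem theoremA (d : ℕ) (α : ℝ) (hα₀ : 0 ≤ α) (hαd : α < d) :
    ∃ K : Set (EuclideanSpace ℝ (Fin d)),
      K.Nonempty ∧ IsCompact K ∧
      dimH K = ENNReal.ofReal α ∧ assouadDim K = ENNReal.ofReal α ∧
      (∀ E ∈ microsets K, modifiedLowerDim E = 0) ∧
      (∀ s : ℝ, 0 < s → ∀ E ∈ microsets K, ∀ F ⊆ E, ¬ IsAhlforsDavidRegular s F) := by
  obtain ⟨K, hne, hcomp, hgap, hdimH, hdimA⟩ : ∃ K : Set (EuclideanSpace ℝ (Fin d)),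
      K.Nonempty ∧ IsCompact K ∧ UniformlyGapped K ∧
        dimH K = ENNReal.ofReal α ∧ assouadDim K = ENNReal.ofReal α := by
    -- For `α = 0` the rate `d / α` is meaningless, and a single point serves.
    rcases hα₀.eq_or_lt with rfl | hα
    · exact ⟨{0}, singleton_nonempty 0, isCompact_singleton, uniformlyGapped_singleton 0,
        by simp, by simp [assouadDim_singleton]⟩
    · exact exists_uniformlyGapped_isCompact_dim_eq d α hα hαd
  exact ⟨K, hne, hcomp, hdimH, hdimA,
    fun E hE => (hgap.hasGaps_of_mem_microsets hE).modifiedLowerDim_eq_zero,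
    fun s hs E hE F hF =>
      ((hgap.hasGaps_of_mem_microsets hE).mono hF).not_isAhlforsDavidRegular hs⟩
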